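/- For a topological space $X$ and $A\subseteq X\times X$, let $P_X(A)$ be the space of continuous paths $\sigma\colon[0,1]\to X$ with $(\sigma(0),\sigma(1))\in A$, with the compact-open topology, and let $\mathrm{TC}_X(A)$ denote the smallest integer $k$ such that $A$ has a cover by open subsets $U_1,\dots,U_k$ of $A$ admitting continuous maps $s_i\colon U_i\to P_X(A)$ with $(s_i(a)(0),s_i(a)(1))=a$ for all $a\in U_i$ ($\mathrm{TC}_X(A)=\infty$ if there is no such $k$). For a space $Y$, let $C^n(Y)=\{(y_1,\dots,y_n)\in Y^n : y_i\ne y_j \text{ for } i\ne j\}$ with the subspace topology, and let $I=[0,1]$. View $C^n(Y)$ as a subspace of $C^n(Y\times I)$ by identifying $Y$ with $Y\times\{0\}$. Proposition. If $m\ge 2$ is an even integer, $n\ge 0$ is an integer and $X=C^n(S^m\times I)$, then $$\mathrm{TC}_X\bigl(C^n(S^m)\times C^n(S^m)\bigr)\le n+2.$$ -/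

import Mathlib

/-- The path space `P_X(A)`: all continuous paths `σ : [0,1] → X` with `(σ 0, σ 1) ∈ A`, as a
subspace of `C([0,1], X)` with the compact-open topology. -/
abbrev RelPathSpace {X : Type*} [TopologicalSpace X] (A : Set (X × X)) : Type _ :=
  {σ : C(unitInterval, X) // (σ 0, σ 1) ∈ A}

/-- There is a cover of `A` by `k` relatively open subsets `U i`, each of which admits a continuous
section `s : U i → P_X(A)` of the endpoint map. -/
def HasMotionPlanner {X : Type*} [TopologicalSpace X] (A : Set (X × X)) (k : ℕ) : Prop :=
  ∃ U : Fin k → Set A,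
    (∀ i, IsOpen (U i)) ∧ (⋃ i, U i) = Set.univ ∧
    ∀ i, ∃ s : U i → RelPathSpace A, Continuous s ∧
      ∀ a : U i, ((s a).1 0, (s a).1 1) = (a : A).1

/-- The (unreduced) relative topological complexity `TC_X(A)` of `A ⊆ X × X`: the least `k` such
that `A` has a motion planner with `k` domains, and `∞` if there is no such `k`. -/
noncomputable def relTC {X : Type*} [TopologicalSpace X] (A : Set (X × X)) : ℕ∞ :=
  ⨅ (k : ℕ) (_ : HasMotionPlanner A k), (k : ℕ∞)

/-- The configuration space `C^n(Y)` of `n`-tuples of pairwise distinct points of `Y`, with the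
subspace topology from `Y^n`. -/
abbrev Conf (n : ℕ) (Y : Type*) : Type _ :=
  {y : Fin n → Y // ∀ i j, i ≠ j → y i ≠ y j}

/-- The inclusion `C^n(Y) → C^n(Y × I)` induced by the identification of `Y` with `Y × {0}`. -/
def confIncl (n : ℕ) (Y : Type*) (y : Conf n Y) : Conf n (Y × unitInterval) :=
  ⟨fun i => (y.1 i, 0), fun i j hij h => y.2 i j hij (congrArg Prod.fst h)⟩

/-- `C^n(Y)` viewed as a subspace of `C^n(Y × I)`. -/
def baseConf (n : ℕ) (Y : Type*) : Set (Conf n (Y × unitInterval)) :=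
  Set.range (confIncl n Y)

/-- The unit sphere `S^m` in `ℝ^(m+1)`. -/
abbrev Sph (m : ℕ) : Type :=
  Metric.sphere (0 : EuclideanSpace ℝ (Fin (m + 1))) 1

/-!
Write a point of `A = C^n(S^m) × C^n(S^m)` as a pair of configurations `(x, y)`. In `S^m × I` the
points can be lifted to pairwise distinct heights, moved independently of one another, each at its
own height, and lowered again (`exists_section_of_familyJoined`). So a section over a subset of `A`
amounts to continuous choices of a path from `x i` to `y i` on the sphere, one for each `i`.

On the sphere, fix a point `p`. Three kinds of pairs `(u, v)` are planned by chains of shortest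
geodesics (`familyJoined_of_mem_region`): `v ≠ -u`, where one geodesic suffices; `u ≠ v` and
`u ≠ p`, where one goes from `u` to `-u` in the direction of a tangent vector field which vanishes
only at `p`, and then to `v`; and `u ≠ -p`, `v ≠ p`, where one passes through `p` and `-p`. The
`level` of `(u, v)`, which is `0`, `1` or `2`, is the first kind that applies. It is an upper
semicontinuous function, equal to `2` only at `(p, -p)`.

Since the points `x i` are distinct, at most one of them is `p`, so the sum of the levels of the
pairs `(x i, y i)` is at most `n + 1` (`sum_level_le`). This gives `n + 2` sets, on each of which
the sum of the levels is constant. By semicontinuity, different vectors of levels with the same sum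
belong to separated subsets of `A`, which have disjoint open neighbourhoods
(`exists_disjoint_open_of_upperSemicontinuous`); hence the motion planners that belong to the
various vectors with a given sum fit together on an open set.
-/

open Topology

/-! ### Continuous families of paths -/

/-- The points `a t` and `b t` can be joined by paths that depend continuously on `t`. -/
def FamilyJoined {ι Y : Type*} [TopologicalSpace ι] [TopologicalSpace Y] (a b : ι → Y) : Prop :=
  ∃ γ : ∀ t, Path (a t) (b t), Continuous ↿γ

theorem FamilyJoined.trans {ι Y : Type*} [TopologicalSpace ι] [TopologicalSpace Y]
    {a b c : ι → Y} (hab : FamilyJoined a b) (hbc : FamilyJoined b c) : FamilyJoined a c := by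
  obtain ⟨γ, hγ⟩ := hab
  obtain ⟨δ, hδ⟩ := hbc
  exact ⟨fun t => (γ t).trans (δ t), Path.trans_continuous_family γ hγ δ hδ⟩

/-! ### Motion planning on spheres -/

section Sphere

variable {E : Type*} [NormedAddCommGroup E] [InnerProductSpace ℝ E]

theorem convexCombination_ne_zero {x y : E} (hx : ‖x‖ = 1) (hy : ‖y‖ = 1) (h : x ≠ -y)
    {s : ℝ} (h0 : 0 ≤ s) (h1 : s ≤ 1) : (1 - s) • x + s • y ≠ 0 := by
  intro h'
  have e : (1 - s) • x = -(s • y) := eq_neg_of_add_eq_zero_left h'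
  have e' := congrArg norm e
  rw [norm_neg, norm_smul, norm_smul, hx, hy, Real.norm_of_nonneg h0,
    Real.norm_of_nonneg (by linarith)] at e'
  have hs : s = 1 / 2 := by linarith
  subst hs
  rw [← smul_neg, show (1 - 1 / 2 : ℝ) = 1 / 2 by norm_num] at e
  exact h (smul_right_injective E (by norm_num : (1 / 2 : ℝ) ≠ 0) e)

/-- Points of a sphere that are never antipodal are joined by the shortest geodesics, obtained by
projecting the segments radially to the sphere. -/
theorem familyJoined_of_ne_neg {ι : Type*} [TopologicalSpace ι]
    {a b : ι → Metric.sphere (0 : E) 1} (ha : Continuous a) (hb : Continuous b)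
    (h : ∀ t, a t ≠ -b t) : FamilyJoined a b := by
  let w : ι × unitInterval → E := fun q => (1 - (q.2 : ℝ)) • (a q.1 : E) + (q.2 : ℝ) • (b q.1 : E)
  have hw : Continuous w := by fun_prop
  have hw0 : ∀ q, w q ≠ 0 := fun q =>
    convexCombination_ne_zero (by simp) (by simp)
      (fun e => h q.1 (Subtype.ext (by simpa using e))) q.2.2.1 q.2.2.2
  let g : ι × unitInterval → Metric.sphere (0 : E) 1 := fun q =>
    ⟨‖w q‖⁻¹ • w q, by simp [norm_smul, hw0 q]⟩
  have hg : Continuous g :=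
    Continuous.subtype_mk ((hw.norm.inv₀ fun q => norm_ne_zero_iff.2 (hw0 q)).smul hw) _
  exact ⟨fun t =>
    { toFun := fun s => g (t, s)
      continuous_toFun := hg.comp (by fun_prop)
      source' := Subtype.ext (by simp [g, w])
      target' := Subtype.ext (by simp [g, w]) }, hg⟩

theorem sphere_ne_neg_of_inner_eq_zero {x y : Metric.sphere (0 : E) 1}
    (h : inner ℝ (x : E) (y : E) = 0) : x ≠ -y := by
  intro e
  simp [e] at h

/-- A tangent vector field on the unit sphere whose only zero is `p`; here `c` is a unit vector
orthogonal to `p`. -/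
noncomputable def tangentField (p c x : E) : E :=
  (1 - inner ℝ p x) • c + inner ℝ c x • (p - x)

theorem inner_tangentField {p c x : E} (hx : ‖x‖ = 1) : inner ℝ x (tangentField p c x) = 0 := by
  simp only [tangentField, inner_add_right, inner_smul_right, inner_sub_right,
    real_inner_self_eq_norm_sq, hx]
  rw [real_inner_comm x p, real_inner_comm x c]
  ring

theorem tangentField_ne_zero {p c x : E} (hp : ‖p‖ = 1) (hc : ‖c‖ = 1) (hx : ‖x‖ = 1)
    (hpc : inner ℝ p c = 0) (hxp : x ≠ p) : tangentField p c x ≠ 0 := by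
  intro h
  have h1 : 1 - inner ℝ p x ≠ 0 := fun e =>
    hxp ((inner_eq_one_iff_of_norm_eq_one (𝕜 := ℝ) hp hx).1 (by linarith)).symm
  have h2 : inner ℝ p (tangentField p c x) = 0 := by rw [h, inner_zero_right]
  simp only [tangentField, inner_add_right, inner_smul_right, inner_sub_right,
    real_inner_self_eq_norm_sq, hp, hpc] at h2
  have h3 : inner ℝ c x = 0 := by
    have : inner ℝ c x * (1 - inner ℝ p x) = 0 := by linarith
    exact (mul_eq_zero.1 this).resolve_right h1
  rw [tangentField, h3, zero_smul, add_zero] at h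
  rcases smul_eq_zero.1 h with h | h
  · exact h1 h
  · simp [h] at hc

/-- The three kinds of pairs on the unit sphere that can be planned continuously. Together they
cover all pairs. -/
def region (p : Metric.sphere (0 : E) 1) :
    ℕ → Set (Metric.sphere (0 : E) 1 × Metric.sphere (0 : E) 1)
  | 0 => {q | q.1 ≠ -q.2}
  | 1 => {q | q.1 ≠ q.2 ∧ q.1 ≠ p}
  | _ => {q | q.1 ≠ -p ∧ q.2 ≠ p}

omit [InnerProductSpace ℝ E] in
theorem isOpen_region (p : Metric.sphere (0 : E) 1) (k : ℕ) : IsOpen (region p k) := by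
  match k with
  | 0 => exact isOpen_ne_fun continuous_fst continuous_snd.neg
  | 1 =>
    exact (isOpen_ne_fun continuous_fst continuous_snd).inter
      (isOpen_ne_fun continuous_fst continuous_const)
  | _ + 2 =>
    exact (isOpen_ne_fun continuous_fst continuous_const).inter
      (isOpen_ne_fun continuous_snd continuous_const)

theorem familyJoined_of_mem_region {ι : Type*} [TopologicalSpace ι]
    {p c : Metric.sphere (0 : E) 1} (hpc : inner ℝ (p : E) (c : E) = 0) (k : ℕ)
    {a b : ι → Metric.sphere (0 : E) 1} (ha : Continuous a) (hb : Continuous b)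
    (h : ∀ t, (a t, b t) ∈ region p k) : FamilyJoined a b := by
  match k with
  | 0 => exact familyJoined_of_ne_neg ha hb h
  | 1 =>
    -- The normalised tangent vector at `a t` is the midpoint of a half circle from `a t` to `-a t`.
    let v : ι → E := fun t => tangentField p c (a t)
    have hv : Continuous v := by unfold v tangentField; fun_prop
    have hv0 : ∀ t, v t ≠ 0 := fun t => tangentField_ne_zero (by simp) (by simp) (by simp) hpc
      (fun e => (h t).2 (Subtype.ext e))
    let d : ι → Metric.sphere (0 : E) 1 := fun t => ⟨‖v t‖⁻¹ • v t, by simp [norm_smul, hv0 t]⟩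
    have hd : Continuous d :=
      Continuous.subtype_mk ((hv.norm.inv₀ fun t => norm_ne_zero_iff.2 (hv0 t)).smul hv) _
    have had : ∀ t, inner ℝ (a t : E) (d t : E) = 0 := fun t => by
      simp only [d, v, inner_smul_right]
      rw [inner_tangentField (by simp), mul_zero]
    refine ((familyJoined_of_ne_neg ha hd fun t => sphere_ne_neg_of_inner_eq_zero (had t)).trans
      (familyJoined_of_ne_neg hd ha.neg fun t => sphere_ne_neg_of_inner_eq_zero ?_)).trans
      (familyJoined_of_ne_neg ha.neg hb fun t e => (h t).1 (neg_injective e))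
    rw [real_inner_comm]
    simpa using had t
  | _ + 2 =>
    -- The path passes through `p`, `c` and `-p`.
    have hp : Continuous fun _ : ι => p := continuous_const
    have hc : Continuous fun _ : ι => c := continuous_const
    refine (((familyJoined_of_ne_neg ha hp fun t => (h t).1).trans
      (familyJoined_of_ne_neg hp hc fun _ => sphere_ne_neg_of_inner_eq_zero hpc)).trans
      (familyJoined_of_ne_neg hc hp.neg fun _ => sphere_ne_neg_of_inner_eq_zero ?_)).trans
      (familyJoined_of_ne_neg hp.neg hb fun t e => (h t).2 (neg_injective e).symm)
    rw [real_inner_comm]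
    simpa using hpc

open Classical in
/-- The index of the first `region` that contains a pair. -/
noncomputable def level (p : Metric.sphere (0 : E) 1)
    (q : Metric.sphere (0 : E) 1 × Metric.sphere (0 : E) 1) : ℕ :=
  if q.1 ≠ -q.2 then 0 else if q.1 ≠ p then 1 else 2

theorem sphere_ne_neg_self (x : Metric.sphere (0 : E) 1) : x ≠ -x :=
  ne_neg_of_mem_unit_sphere ℝ x

theorem mem_region_level (p : Metric.sphere (0 : E) 1)
    (q : Metric.sphere (0 : E) 1 × Metric.sphere (0 : E) 1) : q ∈ region p (level p q) := by
  unfold level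
  split_ifs with h1 h2
  · exact h1
  · exact ⟨fun e => sphere_ne_neg_self q.2 (by rw [← e]; simpa [e] using h1), h2⟩
  · simp only [ne_eq, not_not] at h1 h2
    refine ⟨h2 ▸ sphere_ne_neg_self q.1, fun e => ?_⟩
    rw [h2, e] at h1
    exact sphere_ne_neg_self p h1

omit [InnerProductSpace ℝ E] in
theorem upperSemicontinuous_level (p : Metric.sphere (0 : E) 1) :
    UpperSemicontinuous (level p) := by
  intro q k hk
  by_cases h1 : q.1 ≠ -q.2
  · filter_upwards [(isOpen_region p 0).mem_nhds h1] with r hr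
    have : level p r = 0 := if_pos hr
    omega
  · by_cases h2 : q.1 ≠ p
    · have hq : level p q = 1 := by simp [level, h1, h2]
      filter_upwards [(isOpen_ne_fun continuous_fst continuous_const).mem_nhds h2] with r hr
      have : level p r ≤ 1 := by
        unfold level
        split_ifs with h
        · exact zero_le_one
        · exact le_rfl
      omega
    · have hq : level p q = 2 := by simp [level, h1, h2]
      refine Filter.Eventually.of_forall fun r => ?_
      have : level p r ≤ 2 := by
        unfold level
        split_ifs <;> omega
      omega

omit [InnerProductSpace ℝ E] in
open Classical in
theorem level_le (p : Metric.sphere (0 : E) 1)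
    (q : Metric.sphere (0 : E) 1 × Metric.sphere (0 : E) 1) :
    level p q ≤ 1 + if q.1 = p then 1 else 0 := by
  unfold level
  split_ifs <;> first | omega | contradiction

omit [InnerProductSpace ℝ E] in
/-- Distinct points start at most one pair of level `2`. -/
theorem sum_level_le {n : ℕ} (p : Metric.sphere (0 : E) 1) {x : Fin n → Metric.sphere (0 : E) 1}
    (hx : ∀ i j, i ≠ j → x i ≠ x j) (y : Fin n → Metric.sphere (0 : E) 1) :
    ∑ i, level p (x i, y i) ≤ n + 1 := by
  classical
  calc ∑ i, level p (x i, y i)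
      ≤ ∑ i, (1 + if x i = p then 1 else 0) := Finset.sum_le_sum fun i _ => level_le p (x i, y i)
    _ = n + (Finset.univ.filter fun i => x i = p).card := by
        simp [Finset.sum_add_distrib]
    _ ≤ n + 1 := by
        gcongr
        refine Finset.card_le_one.2 fun i hi j hj => ?_
        simp only [Finset.mem_filter, Finset.mem_univ, true_and] at hi hj
        by_contra hij
        exact hx i j hij (hi.trans hj.symm)

end Sphere

/-! ### Separation of strata -/

/-- The strata of a vector of upper semicontinuous natural-valued functions are separated from one
another as long as their coordinate sums agree: near a point of value `T` all values are `≤ T`, and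
`T` is the only one of these that has the same sum. The disjoint neighbourhoods consist of the
points that are closer to a stratum than to the others with the same sum. -/
theorem exists_disjoint_open_of_upperSemicontinuous {Z α : Type*} [PseudoEMetricSpace Z]
    [Fintype α] {τ : Z → α → ℕ} (hτ : ∀ i, UpperSemicontinuous fun z => τ z i) :
    ∃ V : (α → ℕ) → Set Z, (∀ T, IsOpen (V T)) ∧ (∀ z, z ∈ V (τ z)) ∧
      ∀ T T', ∑ i, T i = ∑ i, T' i → T ≠ T' → Disjoint (V T) (V T') := by
  let F : (α → ℕ) → Set Z := fun T => {z | τ z = T}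
  let G : (α → ℕ) → Set Z := fun T => {z | τ z ≠ T ∧ ∑ i, τ z i = ∑ i, T i}
  have hFG : ∀ T T', ∑ i, T i = ∑ i, T' i → T ≠ T' → F T' ⊆ G T := by
    rintro T T' h hne z rfl
    exact ⟨hne.symm, h.symm⟩
  refine ⟨fun T => {z | Metric.infEDist z (F T) < Metric.infEDist z (G T)}, fun T => ?_,
    fun z => ?_, fun T T' h hne => ?_⟩
  · exact isOpen_lt Metric.continuous_infEDist Metric.continuous_infEDist
  · have hz : z ∉ closure (G (τ z)) := by
      rw [mem_closure_iff_nhds]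
      push Not
      have hev : ∀ᶠ z' in 𝓝 z, ∀ i, τ z' i < τ z i + 1 :=
        Filter.eventually_all.2 fun i => hτ i z _ (Nat.lt_succ_self _)
      refine ⟨_, hev, Set.eq_empty_iff_forall_notMem.2 ?_⟩
      rintro z' ⟨hle, hne, hsum⟩
      refine hne (funext fun i => ?_)
      exact (Finset.sum_eq_sum_iff_of_le fun i _ => Nat.lt_succ_iff.1 (hle i)).1 hsum i
        (Finset.mem_univ i)
    change Metric.infEDist z (F (τ z)) < Metric.infEDist z (G (τ z))
    rw [Metric.infEDist_zero_of_mem (show z ∈ F (τ z) from rfl)]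
    exact pos_iff_ne_zero.2 fun e => hz (Metric.mem_closure_iff_infEDist_zero.2 e)
  · refine Set.disjoint_left.2 fun z hz hz' => ?_
    have h1 := Metric.infEDist_anti (x := z) (hFG T T' h hne)
    have h2 := Metric.infEDist_anti (x := z) (hFG T' T h.symm hne.symm)
    exact absurd (hz.trans_le (h1.trans (hz'.le.trans h2))) (lt_irrefl _)

/-! ### Sections of the endpoint map -/

/-- The endpoint map `P_X(A) → A` has a continuous section over `U`. -/
def HasSectionOn {X : Type*} [TopologicalSpace X] {A : Set (X × X)} (U : Set A) : Prop :=
  ∃ s : U → RelPathSpace A, Continuous s ∧ ∀ a : U, ((s a).1 0, (s a).1 1) = (a : A).1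

theorem HasSectionOn.iUnion {X : Type*} [TopologicalSpace X] {A : Set (X × X)} {ι : Type*}
    {V : ι → Set A} (hV : ∀ i, IsOpen (V i)) (hd : Pairwise fun i j => Disjoint (V i) (V j))
    (h : ∀ i, HasSectionOn (V i)) : HasSectionOn (⋃ i, V i) := by
  choose s hs hsa using h
  have hex : ∀ a : (⋃ i, V i : Set A), ∃ i, a.1 ∈ V i := fun a => Set.mem_iUnion.1 a.2
  choose τ hτ using hex
  refine ⟨fun a => s (τ a) ⟨a.1, hτ a⟩, continuous_iff_continuousAt.2 fun a => ?_,
    fun a => hsa (τ a) ⟨a.1, hτ a⟩⟩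
  have ho : IsOpen {b : (⋃ i, V i : Set A) | b.1 ∈ V (τ a)} :=
    (hV (τ a)).preimage continuous_subtype_val
  refine ContinuousOn.continuousAt ?_ (ho.mem_nhds (hτ a))
  rw [continuousOn_iff_continuous_domRestrict]
  have hc : Continuous fun b : {b : (⋃ i, V i : Set A) | b.1 ∈ V (τ a)} =>
      s (τ a) ⟨b.1.1, b.2⟩ := (hs (τ a)).comp (by fun_prop)
  refine hc.congr fun b => ?_
  -- By disjointness, the index chosen at `b` is the one chosen at `a`.
  have key : ∀ i (hi : b.1.1 ∈ V i), s (τ a) ⟨b.1.1, b.2⟩ = s i ⟨b.1.1, hi⟩ := by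
    intro i hi
    obtain rfl : τ a = i := by
      by_contra hne
      exact Set.disjoint_left.1 (hd hne) b.2 hi
    rfl
  exact key _ (hτ b.1)

/-! ### Configuration spaces -/

/-- The profile of the lifting: it rises from `0` to `1` on `[0, 1/3]`, is `1` on `[1/3, 2/3]`, and
falls back to `0` on `[2/3, 1]`. -/
noncomputable def liftProfile (s : unitInterval) : unitInterval :=
  Set.projIcc (0 : ℝ) 1 zero_le_one (min (3 * (s : ℝ)) (3 - 3 * (s : ℝ)))

/-- The time for the motion on `Y`: it is `0` on `[0, 1/3]`, and `1` on `[2/3, 1]`. -/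
noncomputable def moveTime (s : unitInterval) : unitInterval :=
  Set.projIcc (0 : ℝ) 1 zero_le_one (3 * (s : ℝ) - 1)

theorem continuous_liftProfile : Continuous liftProfile :=
  continuous_projIcc.comp (by fun_prop)

theorem continuous_moveTime : Continuous moveTime :=
  continuous_projIcc.comp (by fun_prop)

theorem liftProfile_zero : liftProfile 0 = 0 :=
  Set.projIcc_of_le_left _ (by simp)

theorem liftProfile_one : liftProfile 1 = 0 :=
  Set.projIcc_of_le_left _ (by simp)

theorem moveTime_zero : moveTime 0 = 0 :=
  Set.projIcc_of_le_left _ (by simp)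

theorem moveTime_one : moveTime 1 = 1 :=
  Set.projIcc_of_right_le _ (by norm_num)

theorem moveTime_or_liftProfile (s : unitInterval) :
    moveTime s = 0 ∨ moveTime s = 1 ∨ liftProfile s = 1 := by
  rcases le_total (3 * (s : ℝ) - 1) 0 with h | h
  · exact Or.inl (Set.projIcc_of_le_left _ h)
  · rcases le_total 1 (3 * (s : ℝ) - 1) with h' | h'
    · exact Or.inr (Or.inl (Set.projIcc_of_right_le _ h'))
    · exact Or.inr (Or.inr (Set.projIcc_of_right_le _ (le_min (by linarith) (by linarith))))

/-- Pairwise distinct heights for `n` points. -/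
noncomputable def pointHeight {n : ℕ} (i : Fin n) : unitInterval :=
  ⟨(i : ℝ) / n, by positivity, div_le_one_of_le₀ (by exact_mod_cast i.2.le) (by positivity)⟩

theorem pointHeight_injective {n : ℕ} : Function.Injective (pointHeight (n := n)) := by
  intro i j h
  have hn : (n : ℝ) ≠ 0 := by exact_mod_cast (Nat.zero_lt_of_lt i.2).ne'
  have h' : (i : ℝ) / n = (j : ℝ) / n := congrArg Subtype.val h
  exact Fin.ext (by exact_mod_cast (div_left_inj' hn).1 h')

theorem apply_eq_of_mem_baseConf {n : ℕ} {Y : Type*} {y : Conf n (Y × unitInterval)}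
    (hy : y ∈ baseConf n Y) (i : Fin n) : y.1 i = ((y.1 i).1, 0) := by
  obtain ⟨x, rfl⟩ := hy
  rfl

theorem fst_ne_of_mem_baseConf {n : ℕ} {Y : Type*} {y : Conf n (Y × unitInterval)}
    (hy : y ∈ baseConf n Y) (i j : Fin n) (hij : i ≠ j) : (y.1 i).1 ≠ (y.1 j).1 := by
  obtain ⟨x, rfl⟩ := hy
  exact x.2 i j hij

theorem continuous_fst_apply {n : ℕ} {Y : Type*} [TopologicalSpace Y] (i : Fin n) :
    Continuous fun y : Conf n (Y × unitInterval) => (y.1 i).1 :=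
  continuous_fst.comp ((continuous_apply i).comp continuous_subtype_val)

/-- Motions of the single points, which may collide in `Y`, give motions of configurations in
`Y × I`: the points are lifted to distinct heights, moved there, and lowered again. -/
theorem exists_section_of_familyJoined {n : ℕ} {Y : Type*} [TopologicalSpace Y]
    {U : Set ↥(baseConf n Y ×ˢ baseConf n Y)}
    (h : ∀ i, FamilyJoined (fun a : U => (a.1.1.1.1 i).1) (fun a : U => (a.1.1.2.1 i).1)) :
    HasSectionOn U := by
  choose γ hγ using h
  let H : U × unitInterval → Conf n (Y × unitInterval) := fun q =>
    ⟨fun i => (γ i q.1 (moveTime q.2), pointHeight i * liftProfile q.2), by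
      intro i j hij e
      obtain ⟨e1, e2⟩ := Prod.ext_iff.1 e
      rcases moveTime_or_liftProfile q.2 with hs | hs | hs
      · simp only [hs, Path.source] at e1
        exact fst_ne_of_mem_baseConf q.1.1.2.1 i j hij e1
      · simp only [hs, Path.target] at e1
        exact fst_ne_of_mem_baseConf q.1.1.2.2 i j hij e1
      · simp only [hs, mul_one] at e2
        exact hij (pointHeight_injective e2)⟩
  have hH : Continuous H := by
    refine Continuous.subtype_mk (continuous_pi fun i => Continuous.prodMk ?_ ?_) _
    · exact (hγ i).comp (continuous_fst.prodMk (continuous_moveTime.comp continuous_snd))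
    · exact continuous_const.mul (continuous_liftProfile.comp continuous_snd)
  have h0 : ∀ a, H (a, 0) = a.1.1.1 := fun a => Subtype.ext <| funext fun i => by
    rw [apply_eq_of_mem_baseConf a.1.2.1 i]
    simp [H, moveTime_zero, liftProfile_zero]
  have h1 : ∀ a, H (a, 1) = a.1.1.2 := fun a => Subtype.ext <| funext fun i => by
    rw [apply_eq_of_mem_baseConf a.1.2.2 i]
    simp [H, moveTime_one, liftProfile_one]
  let K : C(U, C(unitInterval, Conf n (Y × unitInterval))) := ContinuousMap.curry ⟨H, hH⟩
  have hK : ∀ a, (K a 0, K a 1) = a.1.1 := fun a => Prod.ext (h0 a) (h1 a)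
  exact ⟨fun a => ⟨K a, (hK a).symm ▸ a.1.2⟩, K.continuous.subtype_mk _, hK⟩

/-- The motion planner for the unit sphere of an arbitrary inner product space of dimension at
least two. -/
theorem hasMotionPlanner_baseConf_sphere {E : Type*} [NormedAddCommGroup E]
    [InnerProductSpace ℝ E] {p c : Metric.sphere (0 : E) 1}
    (hpc : inner ℝ (p : E) (c : E) = 0) (n : ℕ) :
    HasMotionPlanner (baseConf n (Metric.sphere (0 : E) 1) ×ˢ
      baseConf n (Metric.sphere (0 : E) 1)) (n + 2) := by
  let Z := ↥(baseConf n (Metric.sphere (0 : E) 1) ×ˢ baseConf n (Metric.sphere (0 : E) 1))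
  let f : Fin n → Z → Metric.sphere (0 : E) 1 × Metric.sphere (0 : E) 1 :=
    fun i z => ((z.1.1.1 i).1, (z.1.2.1 i).1)
  have hf : ∀ i, Continuous (f i) := fun i =>
    (continuous_fst_apply i).comp (continuous_fst.comp continuous_subtype_val) |>.prodMk
      ((continuous_fst_apply i).comp (continuous_snd.comp continuous_subtype_val))
  let τ : Z → Fin n → ℕ := fun z i => level p (f i z)
  obtain ⟨V, hVo, hV, hVd⟩ := exists_disjoint_open_of_upperSemicontinuous (τ := τ)
    fun i => (upperSemicontinuous_level p).comp (hf i)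
  let W : (Fin n → ℕ) → Set Z := fun T => V T ∩ ⋂ i, f i ⁻¹' region p (T i)
  have hWo : ∀ T, IsOpen (W T) := fun T =>
    (hVo T).inter (isOpen_iInter_of_finite fun i => (isOpen_region p (T i)).preimage (hf i))
  refine ⟨fun k => ⋃ T : {T : Fin n → ℕ // ∑ i, T i = k}, W T, fun k => isOpen_iUnion fun T =>
    hWo T, Set.eq_univ_of_forall fun z => ?_, fun k => ?_⟩
  · have hle : ∑ i, τ z i ≤ n + 1 := sum_level_le p (fst_ne_of_mem_baseConf z.2.1) _
    exact Set.mem_iUnion.2 ⟨⟨∑ i, τ z i, by omega⟩, Set.mem_iUnion.2 ⟨⟨τ z, rfl⟩, hV z,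
      Set.mem_iInter.2 fun i => mem_region_level p (f i z)⟩⟩
  · refine HasSectionOn.iUnion (fun T => hWo T) (fun T T' hne => ?_) fun T => ?_
    · exact (hVd T T' (T.2.trans T'.2.symm) fun e => hne (Subtype.ext e)).mono
        Set.inter_subset_left Set.inter_subset_left
    · exact exists_section_of_familyJoined fun i =>
        familyJoined_of_mem_region hpc (T.1 i) ((hf i).fst.comp continuous_subtype_val)
          ((hf i).snd.comp continuous_subtype_val) fun a => Set.mem_iInter.1 a.2.2 i

theorem mainTheorem5 (m n : ℕ) (hm : 2 ≤ m) (hme : Even m) :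
    relTC (baseConf n (Sph m) ×ˢ baseConf n (Sph m)) ≤ (n : ℕ∞) + 2 := by
  let e : Fin (m + 1) → Sph m := fun i => ⟨EuclideanSpace.single i 1, by simp⟩
  have he : inner ℝ (e 0 : EuclideanSpace ℝ (Fin (m + 1))) (e (Fin.last m)) = 0 := by
    have : Fin.last m ≠ 0 := fun h => by
      have := congrArg Fin.val h
      simp at this
      omega
    simp [e, EuclideanSpace.inner_single_left, this.symm]
  exact (iInf₂_le (n + 2) (hasMotionPlanner_baseConf_sphere he n)).trans (by simp)
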